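/- **Dimension bound for approximate halting spaces.** *Machines.* Let $M$ be a quantum Turing machine with a finite set $Q$ of control states, initial state $q_0$, final state $q_f\neq q_0$, a two-way infinite tape with the two-track alphabet $\{0,1,\#\}\times\{0,1,\#\}$ (input track and output track), a head that moves left or right in every step, and transition amplitudes such that the induced time evolution $U_M$ on $\mathbb C^Q\otimes\ell^2(T)\otimes\ell^2(\mathbb Z)$ ($T$ = tape contents with finitely many non-blank cells) is unitary. Let $n\in\mathbb N_0$ and let $\mathcal H_n=(\mathbb C^{\{0,1\}})^{\otimes n}$, with unit sphere $S_n$. On input $|\psi\rangle\in\mathcal H_n$ the machine starts with $|\psi\rangle$ on cells $0,\dots,n-1$ of the input track, all else blank, control in $q_0$ and head at $0$; $M^t_{\mathbf C}(|\psi\rangle\langle\psi|)$ denotes the state of the control (partial trace over tape and head) after $t$ steps. For $\varepsilon\ge 0$ and $t\in\mathbb N=\{1,2,\dots\}$, $|\psi\rangle$ is *$\varepsilon$-$t$-halting* if $\langle q_f|M^{t'}_{\mathbf C}(|\psi\rangle\langle\psi|)|q_f\rangle\le\varepsilon$ for all $t'<t$ and $\langle q_f|M^{t}_{\mathbf C}(|\psi\rangle\langle\psi|)|q_f\rangle\ge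 1-\varepsilon$. The open ball $U_\delta(|\varphi\rangle)\subset\mathcal H_n$ is $\varepsilon$-$t$-halting if it contains a unit vector that is $\varepsilon$-$t$-halting. *Subroutines.* Let $\mathcal H_n^{\mathbb Q}$ be the set of vectors with coordinates in $\mathbb Q+i\mathbb Q$. Fix arbitrary procedures $B$, $I$ and a covering procedure with the following properties. - $B(|\varphi\rangle,\delta,\varepsilon,t)\in\{0,1\}$, for $|\varphi\rangle\in\mathcal H_n^{\mathbb Q}$, $\delta,\varepsilon\in\mathbb Q^+$, $t\in\mathbb N$, is $0$ if $U_\delta(|\varphi\rangle)$ is not $\varepsilon$-$t$-halting for $M$, and is $1$ if $U_\delta(|\varphi\rangle)$ is $\frac\varepsilon4$-$t$-halting for $M$. - $I$ takes finite (possibly empty) lists $|\tilde\varphi_1\rangle,\dots,|\tilde\varphi_K\rangle$ and $|\varphi_1\rangle,\dots,|\varphi_N\rangle$ in $\mathcal H_n^{\mathbb Q}$, $d\in\mathbb N$, and rationals $\Delta>\delta>0$, $\tilde\Delta>\tilde\delta>0$. It either fails or returns a subspace $\tilde U\subset\mathcal H_n$, described by $d$ linearly independent vectors of $\mathcal H_n^{\mathbb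 Q}$ that span it. Any returned $\tilde U$ satisfies $\mathrm{dist}(\tilde U,|\varphi_k\rangle)<\Delta$ and $\mathrm{dist}(\tilde U,|\tilde\varphi_l\rangle)>\tilde\delta$ for all $k,l$; and $I$ does not fail if there is a $d$-dimensional subspace $U$ with $\mathrm{dist}(U,|\varphi_k\rangle)\le\delta$ and $\mathrm{dist}(U,|\tilde\varphi_l\rangle)\ge\tilde\Delta$ for all $k,l$. - For rational $\delta>0$ the covering procedure returns a finite list $|\psi_1\rangle,\dots,|\psi_L\rangle\in\mathcal H_n^{\mathbb Q}$ with norms in $(1-\frac\delta2,1+\frac\delta2)$ and $S_n\subset\bigcup_k U_\delta(|\psi_k\rangle)$. *Approximate halting spaces.* For rational $\delta>0$ and $t\in\mathbb N$, the $\delta$-approximate halting space $\mathcal H_M^{(n,\delta)}(t)\subset\mathcal H_n$ is the subspace output by the following algorithm. Start with $\varepsilon:=18\delta$ and the covering $(|\psi_k\rangle)$ for $\delta$. In each round, let the $|\varphi_i\rangle$ be those $|\psi_k\rangle$ with $B(|\psi_k\rangle,\delta,\varepsilon,t)=1$ and the $|\tilde\varphi_i\rangle$ those with $B(|\psi_k\rangle,\delta,18\delta,t)=0$.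 If there are no $|\varphi_i\rangle$, output $\{0\}$ and halt. Otherwise, for $d=2^n,2^n-1,\dots,1$ in this order, run $I$ on these two lists with dimension $d$ and $\Delta=2\delta$, $\delta$, $\tilde\Delta=\frac74\delta$, $\tilde\delta=\frac32\delta$; as soon as it returns a subspace $\tilde U$, output $\tilde U$ and halt. If it fails for every $d$, replace $\varepsilon$ by $\varepsilon/2$ and start the next round. *Statement.* Let $\delta>0$ be rational with $\delta<\frac1{80}\,2^{-2n}$. Then the algorithm halts for every $t\in\mathbb N$, so that all the spaces $\mathcal H_M^{(n,\delta)}(t)$ are defined, and $$\sum_{t\in\mathbb N}\dim\mathcal H_M^{(n,\delta)}(t)\le 2^n .$$ -/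

import Mathlib

/-! ## Quantum Turing machines -/

/-- The symbols of one track: a bit, or the blank symbol (`none`). -/
abbrev TrackSymbol : Type := Option Bool

/-- The two-track alphabet `{0,1,#} × {0,1,#}`: first the input track, then the output track. -/
abbrev TapeSymbol : Type := TrackSymbol × TrackSymbol

/-- The blank symbol of the two-track alphabet. -/
def blankSymbol : TapeSymbol := (none, none)

/-- The two possible movements of the head. -/
inductive HeadMove : Type
  | left : HeadMove
  | right : HeadMove

/-- The displacement of the head. -/
def HeadMove.shift : HeadMove → ℤ
  | .left => -1
  | .right => 1

/-- Classical tape configurations: two-way infinite tapes with finitely many non-blank cells. -/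
abbrev Tape : Type := {x : ℤ → TapeSymbol // {i | x i ≠ blankSymbol}.Finite}

/-- Overwriting one cell of a tape. -/
def Tape.write (x : Tape) (i : ℤ) (a : TapeSymbol) : Tape :=
  ⟨Function.update x.1 i a, (x.2.insert i).subset fun k hk => by
    by_cases h : k = i
    · exact Or.inl h
    · exact Or.inr (by simpa [Function.update_of_ne h] using hk)⟩

/-- The classical tape with the bit string `s` on cells `0, …, n-1` of the input track, all other
cells of the input track and the whole output track being blank. -/
def Tape.ofInput {n : ℕ} (s : Fin n → Bool) : Tape :=
  ⟨fun i => if h : 0 ≤ i ∧ i < n then (some (s ⟨i.toNat, by omega⟩), none) else blankSymbol,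
    (Set.finite_Ico (0 : ℤ) n).subset fun i hi => by
      by_contra h
      exact hi (dif_neg h)⟩

/-- A two-track machine with quantum transition function: a finite set of control states, an
initial state, a different final state, and transition amplitudes. `amp p a b q d` is the amplitude
for writing `b`, entering state `q` and moving in direction `d`, when in state `p` reading `a`. -/
structure TwoTrackMachine where
  Q : Type
  finQ : Fintype Q
  q₀ : Q
  qf : Q
  qf_ne : qf ≠ q₀
  amp : Q → TapeSymbol → TapeSymbol → Q → HeadMove → ℂ

namespace TwoTrackMachine

/-- Classical configurations: control state, tape content, head position. -/
abbrev Config (M : TwoTrackMachine) : Type := M.Q × Tape × ℤ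

/-- The Hilbert space `ℂ^Q ⊗ ℓ²(T) ⊗ ℓ²(ℤ) = ℓ²(Q × T × ℤ)` of the machine. -/
abbrev Space (M : TwoTrackMachine) : Type := lp (fun _ : M.Config => ℂ) 2

open Classical in
/-- The basis vector `|c⟩` of a classical configuration. -/
noncomputable def ket (M : TwoTrackMachine) (c : M.Config) : M.Space := lp.single 2 c 1

/-- The vector into which the transition function takes `|c⟩` in one step. -/
noncomputable def step (M : TwoTrackMachine) : M.Config → M.Space
  | (p, x, h) =>
    letI := M.finQ
    ∑ b : TapeSymbol, ∑ q : M.Q,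
      (M.amp p (x.1 h) b q .left • M.ket (q, x.write h b, h + HeadMove.left.shift) +
        M.amp p (x.1 h) b q .right • M.ket (q, x.write h b, h + HeadMove.right.shift))

end TwoTrackMachine

/-- A quantum Turing machine: a two-track machine whose time evolution operator, the continuous
linear extension of `step`, is unitary. -/
structure QTM extends TwoTrackMachine where
  unitary : ∃ U : toTwoTrackMachine.Space ≃ₗᵢ[ℂ] toTwoTrackMachine.Space,
    ∀ c, U (toTwoTrackMachine.ket c) = toTwoTrackMachine.step c

/-- The Hilbert space `(ℂ^{0,1})^{⊗ n}` of `n` qubits, in the computational basis. -/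
abbrev Qubits (n : ℕ) : Type := EuclideanSpace ℂ (Fin n → Bool)

namespace QTM

/-- The unitary time evolution operator. It is determined by `unitary.choose_spec`, because the
vectors `ket c` span a dense subspace. -/
noncomputable def U (M : QTM) : M.Space ≃ₗᵢ[ℂ] M.Space := M.unitary.choose

/-- The initial state on input `|ψ⟩`: input track `|ψ⟩` on cells `0, …, n-1` and blank elsewhere,
output track blank, control in the initial state, head in position `0`. -/
noncomputable def init (M : QTM) {n : ℕ} (ψ : Qubits n) : M.Space :=
  ∑ s : Fin n → Bool, ψ s • M.ket (M.q₀, Tape.ofInput s, 0)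

/-- The global state vector after `t` steps on input `|ψ⟩`. -/
noncomputable def stateAt (M : QTM) {n : ℕ} (t : ℕ) (ψ : Qubits n) : M.Space :=
  M.U^[t] (M.init ψ)

/-- The state of the control after `t` steps on input `|ψ⟩⟨ψ|`: the partial trace of the global
state over tape and head, as a matrix in the basis of control states. -/
noncomputable def controlState (M : QTM) {n : ℕ} (t : ℕ) (ψ : Qubits n) : Matrix M.Q M.Q ℂ :=
  fun p q => ∑' y : Tape × ℤ, M.stateAt t ψ (p, y) * star (M.stateAt t ψ (q, y))

/-- The (real) diagonal entry of the control state at the final state. -/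
noncomputable def haltProb (M : QTM) {n : ℕ} (t : ℕ) (ψ : Qubits n) : ℝ :=
  (M.controlState t ψ M.qf M.qf).re

/-- `|ψ⟩` is `ε`-`t`-halting for `M`. -/
def IsHalting (M : QTM) {n : ℕ} (ε : ℝ) (t : ℕ) (ψ : Qubits n) : Prop :=
  (∀ t' < t, M.haltProb t' ψ ≤ ε) ∧ 1 - ε ≤ M.haltProb t ψ

/-- The open ball of radius `δ` around `|φ⟩` is `ε`-`t`-halting for `M`: it contains a unit vector
that is `ε`-`t`-halting. -/
def BallIsHalting (M : QTM) {n : ℕ} (δ ε : ℝ) (t : ℕ) (φ : Qubits n) : Prop :=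
  ∃ ψ ∈ Metric.ball φ δ, ‖ψ‖ = 1 ∧ M.IsHalting ε t ψ

end QTM

/-! ## The subroutines of the algorithm -/

/-- Symbolic vectors with coordinates in `ℚ + iℚ` (real part, imaginary part). -/
abbrev RatVec (n : ℕ) : Type := (Fin n → Bool) → ℚ × ℚ

/-- The vector of the `n`-qubit space that a symbolic vector denotes. -/
noncomputable def RatVec.toQubits {n : ℕ} (v : RatVec n) : Qubits n :=
  WithLp.toLp 2 fun s => ((v s).1 : ℂ) + ((v s).2 : ℂ) * Complex.I

/-- An instance, for inputs of length `n`, of the procedure `B` that tests balls for the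
`ε`-`t`-halting property of the machine `M`. (The description of `M`, an argument of the procedure,
is fixed.) -/
structure BallTest (M : QTM) (n : ℕ) where
  /-- the result on input `|φ⟩, δ, ε, t` -/
  test : RatVec n → ℚ → ℚ → ℕ+ → Bool
  eq_false : ∀ (φ : RatVec n) (δ ε : ℚ) (t : ℕ+), 0 < δ → 0 < ε →
    ¬ M.BallIsHalting δ ε t φ.toQubits → test φ δ ε t = false
  eq_true : ∀ (φ : RatVec n) (δ ε : ℚ) (t : ℕ+), 0 < δ → 0 < ε →
    M.BallIsHalting δ (ε / 4) t φ.toQubits → test φ δ ε t = true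

/-- An instance of the procedure `I` that searches for interpolating subspaces. On input
`|φ̃_1⟩, …, |φ̃_K⟩` (`far`), `|φ_1⟩, …, |φ_N⟩` (`near`), `d`, `Δ`, `δ`, `Δ'`, `δ'` it returns either
`none` (the flag `0`) or the flag `1` and a list of `d` linearly independent vectors with rational
coordinates, which describes the subspace that they span. -/
structure Interpolator (n : ℕ) where
  /-- the result on input `far, near, d, Δ, δ, Δ', δ'` -/
  search : List (RatVec n) → List (RatVec n) → (d : ℕ) → ℚ → ℚ → ℚ → ℚ →
    Option (Fin d → RatVec n)
  sound : ∀ (far near : List (RatVec n)) (d : ℕ) (Δ δ Δ' δ' : ℚ), 1 ≤ d →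
    0 < δ → δ < Δ → 0 < δ' → δ' < Δ' →
    ∀ u, search far near d Δ δ Δ' δ' = some u →
      LinearIndependent ℂ (fun i => (u i).toQubits) ∧
      (∀ φ ∈ near, Metric.infDist φ.toQubits
        (Submodule.span ℂ (Set.range fun i => (u i).toQubits) : Set (Qubits n)) < Δ) ∧
      (∀ φ ∈ far, δ' < Metric.infDist φ.toQubits
        (Submodule.span ℂ (Set.range fun i => (u i).toQubits) : Set (Qubits n)))
  complete : ∀ (far near : List (RatVec n)) (d : ℕ) (Δ δ Δ' δ' : ℚ), 1 ≤ d →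
    0 < δ → δ < Δ → 0 < δ' → δ' < Δ' →
    (∃ W : Submodule ℂ (Qubits n), Module.finrank ℂ W = d ∧
      (∀ φ ∈ near, Metric.infDist φ.toQubits (W : Set (Qubits n)) ≤ δ) ∧
      (∀ φ ∈ far, Δ' ≤ Metric.infDist φ.toQubits (W : Set (Qubits n)))) →
    ∃ u, search far near d Δ δ Δ' δ' = some u

/-- An instance of the procedure that covers the unit sphere of the `n`-qubit space by open balls
of radius `δ` whose centres have rational coordinates and norm in `(1 - δ/2, 1 + δ/2)`. -/
structure SphereCover (n : ℕ) where
  /-- the centres of the balls, for the radius `δ` -/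
  centres : ℚ → List (RatVec n)
  norm_mem : ∀ δ : ℚ, 0 < δ → ∀ ψ ∈ centres δ,
    ‖ψ.toQubits‖ ∈ Set.Ioo (1 - (δ : ℝ) / 2) (1 + (δ : ℝ) / 2)
  covers : ∀ δ : ℚ, 0 < δ → ∀ φ : Qubits n, ‖φ‖ = 1 →
    ∃ ψ ∈ centres δ, φ ∈ Metric.ball ψ.toQubits δ

/-! ## The algorithm -/

section Algorithm

variable {M : QTM} {n : ℕ} (B : BallTest M n) (I : Interpolator n) (C : SphereCover n)

/-- The accuracy `ε` in round `j` of the algorithm: it starts with `18 δ` and is halved after every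
round. -/
def roundAccuracy (δ : ℚ) (j : ℕ) : ℚ := 18 * δ / 2 ^ j

/-- The search of one round: the dimensions `d = m, m - 1, …, 1` are tried one after the other,
until an interpolating subspace of dimension `d` is found. -/
noncomputable def searchDown (far near : List (RatVec n)) (δ : ℚ) :
    ℕ → Option (Submodule ℂ (Qubits n))
  | 0 => none
  | d + 1 =>
    match I.search far near (d + 1) (2 * δ) δ (7 / 4 * δ) (3 / 2 * δ) with
    | some u => some (Submodule.span ℂ (Set.range fun i => (u i).toQubits))
    | none => searchDown far near δ d

/-- Round `j` of the algorithm: its output, or `none` if the algorithm goes on with the next round.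
The `near` vectors are the centres whose balls pass the test with the current accuracy, the `far`
vectors those whose balls fail it with accuracy `18 δ`. If no ball passes, the output is `{0}`. -/
noncomputable def algorithmRound (δ : ℚ) (t : ℕ+) (j : ℕ) :
    Option (Submodule ℂ (Qubits n) × ℚ) :=
  let ε := roundAccuracy δ j
  let near := (C.centres δ).filter fun ψ => B.test ψ δ ε t
  let far := (C.centres δ).filter fun ψ => !B.test ψ δ (18 * δ) t
  if near = [] then some (⊥, ε)
  else (searchDown I far near δ (2 ^ n)).map fun W => (W, ε)

/-- The output of the algorithm, which is defined if some round produces one: the approximate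
halting space and the approximate halting accuracy. -/
noncomputable def approxHalting (δ : ℚ) (t : ℕ+) : Part (Submodule ℂ (Qubits n) × ℚ) where
  Dom := ∃ j, (algorithmRound B I C δ t j).isSome
  get h := (algorithmRound B I C δ t (Nat.find h)).get (Nat.find_spec h)

end Algorithm

/-! ## Almost orthogonal families -/

section AlmostOrthogonal

variable {E : Type*} [NormedAddCommGroup E] [InnerProductSpace ℂ E]

/-! If one input has nearly halted at time `t` and another has hardly halted by then, their evolved
states lie almost in complementary orthogonal subspaces. Since evolution is isometric, the inputs
themselves are almost orthogonal (`QTM.IsHalting.norm_inner_le`). Every unit vector output for time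
`t` is `20δ`-`t`-halting (`algorithmRound_isHalting`), so unit vectors from spaces for different
times have inner product at most `2√(20δ) < 2⁻ⁿ`. The union of orthonormal bases of finitely many of
these spaces then has at most `2ⁿ` elements, by diagonal dominance of Gram matrices
(`sum_finrank_le_of_norm_inner_lt`).

Termination comes from the space of inputs that halt exactly at time `t`. Once `ε` is small,
compactness puts every accepted centre within `δ` of it, while rejected centres are always at least
`7/4 δ` away. It is therefore an admissible interpolating subspace, and `I` cannot fail in its
dimension (`approxHalting_dom`). -/

theorem linearIndependent_of_sum_norm_inner_lt_one {ι : Type*} [Fintype ι] [DecidableEq ι]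
    (v : ι → E) (hv : ∀ i, ‖v i‖ = 1)
    (h : ∀ i, ∑ j ∈ Finset.univ.erase i, ‖inner ℂ (v i) (v j)‖ < 1) :
    LinearIndependent ℂ v := by
  rw [Fintype.linearIndependent_iff]
  intro c hc
  -- The hypothesis says that the Gram matrix is strictly diagonally dominant, hence invertible
  -- (Gershgorin).
  have hdet : (Matrix.of fun i j => inner ℂ (v i) (v j) : Matrix ι ι ℂ).det ≠ 0 := by
    refine det_ne_zero_of_sum_row_lt_diag fun k => ?_
    have hk : ‖(inner ℂ (v k) (v k) : ℂ)‖ = 1 := by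
      rw [inner_self_eq_norm_sq_to_K, hv]; simp
    simpa only [Matrix.of_apply, hk] using h k
  have hmul : (Matrix.of fun i j => inner ℂ (v i) (v j) : Matrix ι ι ℂ).mulVec c = 0 := by
    funext i
    have := congrArg (fun x => inner ℂ (v i) x) hc
    simp only [inner_sum, inner_smul_right, inner_zero_right] at this
    simpa [Matrix.mulVec, dotProduct, mul_comm] using this
  exact fun i => congrFun (Matrix.eq_zero_of_mulVec_eq_zero hdet hmul) i

/-- Among `N + 1` such vectors, `N` being the dimension, each Gram row has `N` off-diagonal entries
below `1/N`, so these vectors would be independent. -/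
theorem card_le_finrank_of_norm_inner_lt [FiniteDimensional ℂ E] {ι : Type*} [Fintype ι]
    (v : ι → E) (hv : ∀ i, ‖v i‖ = 1)
    (h : ∀ i j, i ≠ j → ‖inner ℂ (v i) (v j)‖ < ((Module.finrank ℂ E : ℝ))⁻¹) :
    Fintype.card ι ≤ Module.finrank ℂ E := by
  by_contra! hlt
  set N := Module.finrank ℂ E with hN
  obtain ⟨f⟩ : Nonempty (Fin (N + 1) ↪ ι) :=
    Function.Embedding.nonempty_of_card_le (by simpa using hlt)
  have hNpos : N ≠ 0 := by
    intro h0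
    have : Subsingleton E := Module.finrank_zero_iff.mp (hN.symm.trans h0)
    have := hv (f 0)
    rw [Subsingleton.elim (v (f 0)) 0, norm_zero] at this
    exact zero_ne_one this
  have hli : LinearIndependent ℂ (v ∘ f) := by
    refine linearIndependent_of_sum_norm_inner_lt_one _ (fun i => hv _) fun i => ?_
    have hcard : (Finset.univ.erase i).card = N := by simp
    calc ∑ j ∈ Finset.univ.erase i, ‖inner ℂ ((v ∘ f) i) ((v ∘ f) j)‖
        < ∑ _j ∈ Finset.univ.erase i, (N : ℝ)⁻¹ := by
          refine Finset.sum_lt_sum_of_nonempty ?_ fun j hj => ?_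
          · rw [← Finset.card_pos, hcard]; omega
          · exact h _ _ fun e => Finset.ne_of_mem_erase hj (f.injective e).symm
      _ = 1 := by
          rw [Finset.sum_const, hcard, nsmul_eq_mul, mul_inv_cancel₀ (by exact_mod_cast hNpos)]
  have := hli.fintype_card_le_finrank
  simp at this
  omega

/-- Finitely many subspaces whose unit vectors have pairwise inner products less than the inverse
of the dimension of the whole space have total dimension at most that dimension. -/
theorem sum_finrank_le_of_norm_inner_lt [FiniteDimensional ℂ E] {ι : Type*} (s : Finset ι)
    (W : ι → Submodule ℂ E)
    (h : ∀ i j, i ≠ j → ∀ x ∈ W i, ∀ y ∈ W j, ‖x‖ = 1 → ‖y‖ = 1 →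
      ‖inner ℂ x y‖ < ((Module.finrank ℂ E : ℝ))⁻¹) :
    ∑ i ∈ s, Module.finrank ℂ (W i) ≤ Module.finrank ℂ E := by
  -- All bases are merged into one family: inner products vanish within a space and are small by
  -- hypothesis across spaces.
  let b : ∀ i, OrthonormalBasis (Fin (Module.finrank ℂ (W i))) ℂ (W i) :=
    fun i => stdOrthonormalBasis ℂ (W i)
  let v : (Σ i : s, Fin (Module.finrank ℂ (W i))) → E := fun k => (b k.1 k.2 : E)
  have hv : ∀ k, ‖v k‖ = 1 := fun k => (b k.1).orthonormal.1 k.2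
  have hcard := card_le_finrank_of_norm_inner_lt v hv ?_
  · rw [Fintype.card_sigma] at hcard
    simp only [Fintype.card_fin] at hcard
    rwa [Finset.sum_coe_sort s (fun i => Module.finrank ℂ (W i))] at hcard
  · rintro ⟨i, k⟩ ⟨j, l⟩ hne
    by_cases hij : i = j
    · subst hij
      have hkl : k ≠ l := fun e => hne (by rw [e])
      have h0 : inner ℂ (v ⟨i, k⟩) (v ⟨i, l⟩) = 0 := (b i).orthonormal.2 hkl
      rw [h0, norm_zero, inv_pos, Nat.cast_pos, Nat.pos_iff_ne_zero]
      intro hz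
      have : Subsingleton E := Module.finrank_zero_iff.mp hz
      have := hv ⟨i, k⟩
      rw [Subsingleton.elim (v ⟨i, k⟩) 0, norm_zero] at this
      exact zero_ne_one this
    · exact h i j (fun e => hij (Subtype.ext e)) _ (b i k).2 _ (b j l).2 (hv ⟨i, k⟩) (hv ⟨j, l⟩)

end AlmostOrthogonal

/-! ## Halting probabilities as squared norms -/

namespace TwoTrackMachine

variable (M : TwoTrackMachine)

open Classical in
/-- The projection of the machine's Hilbert space onto the vectors with control in the final
state. -/
noncomputable def haltProj : M.Space →ₗ[ℂ] M.Space where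
  toFun x := ⟨fun c => if c.1 = M.qf then x c else 0, (lp.memℓp x).mono' fun c => by
    split_ifs <;> simp⟩
  map_add' x y := by
    ext c
    change (if c.1 = M.qf then x c + y c else 0) =
      (if c.1 = M.qf then x c else 0) + if c.1 = M.qf then y c else 0
    split_ifs <;> simp
  map_smul' a x := by
    ext c
    by_cases h : c.1 = M.qf <;> simp [h]

theorem haltProj_apply_of_eq (x : M.Space) {c : M.Config} (h : c.1 = M.qf) :
    M.haltProj x c = x c := if_pos h

theorem haltProj_apply_of_ne (x : M.Space) {c : M.Config} (h : c.1 ≠ M.qf) :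
    M.haltProj x c = 0 := if_neg h

theorem inner_haltProj_sub (x y : M.Space) :
    inner ℂ (M.haltProj x) (y - M.haltProj y) = 0 := by
  rw [lp.inner_eq_tsum]
  refine (tsum_congr fun c => ?_).trans tsum_zero
  by_cases h : c.1 = M.qf
  · simp [haltProj_apply_of_eq M _ h]
  · simp [haltProj_apply_of_ne M _ h]

theorem inner_eq_haltProj_add (x y : M.Space) :
    inner ℂ x y = inner ℂ (M.haltProj x) (M.haltProj y)
      + inner ℂ (x - M.haltProj x) (y - M.haltProj y) := by
  have h1 := M.inner_haltProj_sub x y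
  have h2 := congrArg (starRingEnd ℂ) (M.inner_haltProj_sub y x)
  rw [inner_conj_symm, map_zero] at h2
  simp only [inner_sub_right, inner_sub_left] at h1 h2 ⊢
  linear_combination h1 + h2

theorem norm_sq_eq_haltProj_add (x : M.Space) :
    ‖x‖ ^ 2 = ‖M.haltProj x‖ ^ 2 + ‖x - M.haltProj x‖ ^ 2 := by
  have h := congrArg Complex.re (M.inner_eq_haltProj_add x x)
  simpa only [Complex.add_re, inner_self_eq_norm_sq_to_K, ← Complex.ofReal_pow,
    Complex.coe_algebraMap, Complex.ofReal_re] using h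

theorem norm_haltProj_le (x : M.Space) : ‖M.haltProj x‖ ≤ ‖x‖ := by
  refine le_of_sq_le_sq ?_ (norm_nonneg _)
  nlinarith [M.norm_sq_eq_haltProj_add x, sq_nonneg ‖x - M.haltProj x‖]

theorem norm_sub_haltProj_le (x : M.Space) : ‖x - M.haltProj x‖ ≤ ‖x‖ := by
  refine le_of_sq_le_sq ?_ (norm_nonneg _)
  nlinarith [M.norm_sq_eq_haltProj_add x, sq_nonneg ‖M.haltProj x‖]

theorem norm_sq_haltProj (x : M.Space) :
    ‖M.haltProj x‖ ^ 2 = ∑' y : Tape × ℤ, ‖x (M.qf, y)‖ ^ 2 := by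
  have h := lp.norm_rpow_eq_tsum (p := 2) (by simp) (M.haltProj x)
  simp only [ENNReal.toReal_ofNat, Real.rpow_ofNat] at h
  rw [h]
  have hinj : Function.Injective fun y : Tape × ℤ => ((M.qf, y) : M.Config) :=
    fun a b hab => (Prod.ext_iff.mp hab).2
  rw [← hinj.tsum_eq (f := fun c => ‖M.haltProj x c‖ ^ 2)]
  · exact tsum_congr fun y => by rw [haltProj_apply_of_eq M x rfl]
  · intro c hc
    by_cases hq : c.1 = M.qf
    · exact ⟨c.2, by rw [← hq]⟩
    · simp [haltProj_apply_of_ne M _ hq] at hc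

/-- The probability of halting is Lipschitz on the unit sphere, with constant `1`. -/
theorem norm_sq_haltProj_le_add (a b : M.Space) (ha : ‖a‖ = 1) (hb : ‖b‖ = 1) :
    ‖M.haltProj a‖ ^ 2 ≤ ‖M.haltProj b‖ ^ 2 + ‖a - b‖ := by
  have ea := M.norm_sq_eq_haltProj_add a
  have eb := M.norm_sq_eq_haltProj_add b
  have ed := M.norm_sq_eq_haltProj_add (a - b)
  have h1 : |‖M.haltProj a‖ - ‖M.haltProj b‖| ≤ ‖M.haltProj (a - b)‖ := by
    rw [map_sub]; exact abs_norm_sub_norm_le _ _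
  have h2 : |‖a - M.haltProj a‖ - ‖b - M.haltProj b‖| ≤ ‖(a - b) - M.haltProj (a - b)‖ := by
    rw [map_sub, sub_sub_sub_comm]; exact abs_norm_sub_norm_le _ _
  rw [ha] at ea
  rw [hb] at eb
  have h1' := sq_le_sq' (neg_le_of_abs_le h1) (le_of_abs_le h1)
  have h2' := sq_le_sq' (neg_le_of_abs_le h2) (le_of_abs_le h2)
  generalize ‖M.haltProj a‖ = a₁ at *
  generalize ‖M.haltProj b‖ = b₁ at *
  generalize ‖a - M.haltProj a‖ = a₂ at *
  generalize ‖b - M.haltProj b‖ = b₂ at *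
  -- The points `(a₁, a₂)` and `(b₁, b₂)` lie on the unit circle. Cauchy–Schwarz on `2(a₁² - b₁²)`,
  -- with second factor at most `4`, gives the Lipschitz constant `1`.
  have hd : (a₁ - b₁) ^ 2 + (a₂ - b₂) ^ 2 ≤ ‖a - b‖ ^ 2 := by linarith
  have hs : (a₁ + b₁) ^ 2 + (a₂ + b₂) ^ 2 ≤ 4 := by nlinarith [sq_nonneg (a₁ - b₁), sq_nonneg (a₂ - b₂)]
  have hsq : (a₁ ^ 2 - b₁ ^ 2) ^ 2 ≤ ‖a - b‖ ^ 2 := by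
    have e : 2 * (a₁ ^ 2 - b₁ ^ 2) = (a₁ - b₁) * (a₁ + b₁) - (a₂ - b₂) * (a₂ + b₂) := by
      linear_combination eb - ea
    have cs : (2 * (a₁ ^ 2 - b₁ ^ 2)) ^ 2 ≤
        ((a₁ - b₁) ^ 2 + (a₂ - b₂) ^ 2) * ((a₁ + b₁) ^ 2 + (a₂ + b₂) ^ 2) := by
      rw [e]
      nlinarith [sq_nonneg ((a₁ - b₁) * (a₂ + b₂) + (a₂ - b₂) * (a₁ + b₁))]
    have := mul_le_mul hd hs (by positivity) (by positivity)
    linarith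
  have := le_of_abs_le (abs_le_of_sq_le_sq hsq (norm_nonneg _))
  linarith

open Classical in
theorem inner_ket_ket (c c' : M.Config) :
    inner ℂ (M.ket c) (M.ket c') = if c = c' then (1 : ℂ) else 0 := by
  rw [ket, lp.inner_single_left]
  by_cases h : c = c'
  · subst h; simp [ket]
  · simp [ket, h]

end TwoTrackMachine

theorem Tape.ofInput_injective {n : ℕ} :
    Function.Injective (Tape.ofInput : (Fin n → Bool) → Tape) := by
  intro s s' h
  funext i
  have hi := congrFun (congrArg Subtype.val h) (i : ℤ)
  simpa [Tape.ofInput] using hi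

/-! ### Evolution of inputs, approximate and exact halting -/

namespace QTM

variable (M : QTM) {n : ℕ}

theorem norm_init (ψ : Qubits n) : ‖M.init ψ‖ = ‖ψ‖ := by
  have ho : Orthonormal ℂ fun s : Fin n → Bool => M.ket (M.q₀, Tape.ofInput s, 0) := by
    classical
    rw [orthonormal_iff_ite]
    intro s s'
    rw [M.inner_ket_ket]
    simp [Tape.ofInput_injective.eq_iff]
  have h := ho.inner_sum ψ ψ Finset.univ
  have h' : inner ℂ (M.init ψ) (M.init ψ) = inner ℂ ψ ψ := by
    rw [init, h, PiLp.inner_apply]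
    simp [mul_comm, Complex.mul_conj']
  rw [norm_eq_sqrt_re_inner (𝕜 := ℂ), norm_eq_sqrt_re_inner (𝕜 := ℂ), h']

/-- The map from the input to the global state after `t` steps. -/
noncomputable def evolution (n t : ℕ) : Qubits n →ₗᵢ[ℂ] M.Space where
  toFun := M.stateAt t
  map_add' ψ φ := by
    have h0 : M.init (ψ + φ) = M.init ψ + M.init φ := by
      simp [init, add_smul, Finset.sum_add_distrib]
    induction t with
    | zero => exact h0
    | succ t ih =>
      simp only [stateAt, Function.iterate_succ_apply'] at ih ⊢
      rw [ih, map_add]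
  map_smul' a ψ := by
    have h0 : M.init (a • ψ) = a • M.init ψ := by
      simp [init, mul_smul, Finset.smul_sum]
    induction t with
    | zero => exact h0
    | succ t ih =>
      simp only [stateAt, Function.iterate_succ_apply'] at ih ⊢
      rw [ih, map_smul]
  norm_map' ψ := by
    change ‖M.stateAt t ψ‖ = ‖ψ‖
    induction t with
    | zero => exact M.norm_init ψ
    | succ t ih =>
      simp only [stateAt, Function.iterate_succ_apply'] at ih ⊢
      rw [LinearIsometryEquiv.norm_map, ih]

theorem haltProb_eq (t : ℕ) (ψ : Qubits n) :
    M.haltProb t ψ = ‖M.haltProj (M.evolution n t ψ)‖ ^ 2 := by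
  rw [M.norm_sq_haltProj, haltProb, controlState]
  have h : ∀ z : ℂ, z * star z = ((‖z‖ ^ 2 : ℝ) : ℂ) := fun z => by
    simp [Complex.mul_conj']
  simp only [h]
  rw [← Complex.ofReal_tsum, Complex.ofReal_re]
  rfl

theorem haltProb_eq_one_sub (t : ℕ) {ψ : Qubits n} (hψ : ‖ψ‖ = 1) :
    M.haltProb t ψ =
      1 - ‖M.evolution n t ψ - M.haltProj (M.evolution n t ψ)‖ ^ 2 := by
  have h := M.norm_sq_eq_haltProj_add (M.evolution n t ψ)
  rw [LinearIsometry.norm_map, hψ] at h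
  rw [haltProb_eq]
  linarith

theorem haltProb_le_add (t : ℕ) {ψ φ : Qubits n} (hψ : ‖ψ‖ = 1) (hφ : ‖φ‖ = 1) :
    M.haltProb t ψ ≤ M.haltProb t φ + ‖ψ - φ‖ := by
  rw [haltProb_eq, haltProb_eq, ← (M.evolution n t).norm_map (ψ - φ), map_sub]
  exact M.norm_sq_haltProj_le_add _ _ (by simpa) (by simpa)

theorem continuous_haltProb (t : ℕ) : Continuous (M.haltProb t : Qubits n → ℝ) := by
  have h : (M.haltProb t : Qubits n → ℝ) =
      fun ψ => ‖(M.haltProj ∘ₗ (M.evolution n t).toLinearMap) ψ‖ ^ 2 :=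
    funext fun ψ => M.haltProb_eq t ψ
  rw [h]
  exact (LinearMap.continuous_of_finiteDimensional _).norm.pow 2

variable {M}

theorem IsHalting.mono {ε ε' : ℝ} {t : ℕ} {ψ : Qubits n} (h : M.IsHalting ε t ψ) (hε : ε ≤ ε') :
    M.IsHalting ε' t ψ :=
  ⟨fun t' ht' => (h.1 t' ht').trans hε, by linarith [h.2]⟩

theorem IsHalting.of_norm_sub_le {ε η : ℝ} {t : ℕ} {ψ φ : Qubits n} (h : M.IsHalting ε t φ)
    (hψ : ‖ψ‖ = 1) (hφ : ‖φ‖ = 1) (hd : ‖ψ - φ‖ ≤ η) : M.IsHalting (ε + η) t ψ := by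
  refine ⟨fun t' ht' => ?_, ?_⟩
  · linarith [h.1 t' ht', M.haltProb_le_add t' hψ hφ]
  · have := M.haltProb_le_add t hφ hψ
    rw [norm_sub_rev] at this
    linarith [h.2]

/-- Inputs that halt at different times are almost orthogonal. -/
theorem IsHalting.norm_inner_le {ε : ℝ} {t t' : ℕ} {ψ φ : Qubits n} (htt' : t < t')
    (hψ : ‖ψ‖ = 1) (hφ : ‖φ‖ = 1) (h : M.IsHalting ε t ψ) (h' : M.IsHalting ε t' φ) :
    ‖inner ℂ ψ φ‖ ≤ 2 * √ε := by
  have h1 := h.2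
  have h2 := h'.1 t htt'
  rw [haltProb_eq_one_sub M t hψ] at h1
  rw [haltProb_eq] at h2
  -- Both states are compared at the earlier time `t`. In the halting part `φ` contributes at most
  -- `√ε`, in the non-halting part `ψ` does.
  rw [← (M.evolution n t).inner_map_map, M.inner_eq_haltProj_add]
  have nψ : ‖M.haltProj (M.evolution n t ψ)‖ ≤ 1 := by
    simpa [hψ] using M.norm_haltProj_le (M.evolution n t ψ)
  have nφ : ‖M.evolution n t φ - M.haltProj (M.evolution n t φ)‖ ≤ 1 := by
    simpa [hφ] using M.norm_sub_haltProj_le (M.evolution n t φ)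
  have e1 : ‖M.evolution n t ψ - M.haltProj (M.evolution n t ψ)‖ ≤ √ε :=
    Real.le_sqrt_of_sq_le (by linarith)
  have e2 : ‖M.haltProj (M.evolution n t φ)‖ ≤ √ε := Real.le_sqrt_of_sq_le h2
  have s0 := Real.sqrt_nonneg ε
  refine (norm_add_le _ _).trans ?_
  refine (add_le_add (norm_inner_le_norm _ _) (norm_inner_le_norm _ _)).trans ?_
  have := mul_le_mul nψ e2 (norm_nonneg _) zero_le_one
  have := mul_le_mul e1 nφ (norm_nonneg _) s0
  linarith

variable (M)

/-- The space of the inputs that halt exactly at time `t`. -/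
noncomputable def haltingSpace (n t : ℕ) : Submodule ℂ (Qubits n) :=
  (⨅ t' : Fin t, LinearMap.ker (M.haltProj ∘ₗ (M.evolution n t').toLinearMap)) ⊓
    LinearMap.ker ((LinearMap.id - M.haltProj) ∘ₗ (M.evolution n t).toLinearMap)

theorem mem_haltingSpace {t : ℕ} {ψ : Qubits n} :
    ψ ∈ M.haltingSpace n t ↔ (∀ t' < t, M.haltProj (M.evolution n t' ψ) = 0) ∧
      M.evolution n t ψ - M.haltProj (M.evolution n t ψ) = 0 := by
  simp only [haltingSpace, Submodule.mem_inf, Submodule.mem_iInf, LinearMap.mem_ker,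
    LinearMap.comp_apply, LinearMap.sub_apply, LinearMap.id_apply, LinearIsometry.coe_toLinearMap,
    Fin.forall_iff]

variable {M}

theorem IsHalting.mem_haltingSpace {t : ℕ} {ψ : Qubits n} (hψ : ‖ψ‖ = 1)
    (h : M.IsHalting 0 t ψ) : ψ ∈ M.haltingSpace n t := by
  rw [M.mem_haltingSpace]
  refine ⟨fun t' ht' => ?_, ?_⟩
  · have := h.1 t' ht'
    rw [haltProb_eq] at this
    exact norm_eq_zero.mp (pow_eq_zero_iff two_ne_zero |>.mp (le_antisymm this (sq_nonneg _)))
  · have := h.2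
    rw [haltProb_eq_one_sub M t hψ] at this
    exact norm_eq_zero.mp (pow_eq_zero_iff two_ne_zero |>.mp
      (le_antisymm (by linarith) (sq_nonneg _)))

/-- Only `ψ - w` contributes amplitude to the wrong outcomes, so the error probabilities are at most
`η ^ 2`. By linearity `w` need not be a unit vector. -/
theorem isHalting_of_mem_haltingSpace {t : ℕ} {ψ w : Qubits n} {η : ℝ} (hψ : ‖ψ‖ = 1)
    (hw : w ∈ M.haltingSpace n t) (hd : ‖ψ - w‖ ≤ η) : M.IsHalting (η ^ 2) t ψ := by
  rw [M.mem_haltingSpace] at hw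
  refine ⟨fun t' ht' => ?_, ?_⟩
  · rw [haltProb_eq]
    have : M.haltProj (M.evolution n t' ψ) = M.haltProj (M.evolution n t' (ψ - w)) := by
      rw [map_sub, map_sub, hw.1 t' ht', sub_zero]
    rw [this]
    refine pow_le_pow_left₀ (norm_nonneg _) ((M.norm_haltProj_le _).trans ?_) 2
    rwa [LinearIsometry.norm_map]
  · rw [haltProb_eq_one_sub M t hψ]
    have : M.evolution n t ψ - M.haltProj (M.evolution n t ψ) =
        M.evolution n t (ψ - w) - M.haltProj (M.evolution n t (ψ - w)) := by
      rw [map_sub, map_sub, sub_sub_sub_comm, hw.2, sub_zero]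
    rw [this]
    have := pow_le_pow_left₀ (norm_nonneg _) ((M.norm_sub_haltProj_le _).trans
      (((M.evolution n t).norm_map (ψ - w)).le.trans hd)) 2
    linarith

/-- If a closed ball contains unit vectors that are `ε`-`t`-halting for accuracies `ε` tending
to zero, then it contains one that halts exactly at time `t`. -/
theorem exists_isHalting_zero {t : ℕ} {δ : ℝ} {φ : Qubits n} {ε : ℕ → ℝ} (hε : Antitone ε)
    (hε0 : Filter.Tendsto ε Filter.atTop (nhds 0))
    (h : ∀ j, ∃ ψ ∈ Metric.closedBall φ δ, ‖ψ‖ = 1 ∧ M.IsHalting (ε j) t ψ) :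
    ∃ ψ ∈ Metric.closedBall φ δ, ‖ψ‖ = 1 ∧ M.IsHalting 0 t ψ := by
  let K : ℕ → Set (Qubits n) := fun j =>
    Metric.closedBall φ δ ∩ ({ψ | ‖ψ‖ = 1} ∩ {ψ | M.IsHalting (ε j) t ψ})
  have hcl : ∀ j, IsClosed (K j) := by
    refine fun j => Metric.isClosed_closedBall.inter
      ((isClosed_eq continuous_norm continuous_const).inter ?_)
    have : {ψ : Qubits n | M.IsHalting (ε j) t ψ} =
        (⋂ t', ⋂ (_ : t' < t), {ψ | M.haltProb t' ψ ≤ ε j}) ∩ {ψ | 1 - ε j ≤ M.haltProb t ψ} := by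
      ext ψ; simp [IsHalting]
    rw [this]
    exact (isClosed_iInter fun t' => isClosed_iInter fun _ =>
      isClosed_le (M.continuous_haltProb t') continuous_const).inter
      (isClosed_le continuous_const (M.continuous_haltProb t))
  -- Cantor's intersection theorem: the sets `K j` are nonempty, compact and decreasing.
  obtain ⟨ψ, hψ⟩ := IsCompact.nonempty_iInter_of_sequence_nonempty_isCompact_isClosed K
    (fun j ψ hψ => ⟨hψ.1, hψ.2.1, hψ.2.2.mono (hε j.le_succ)⟩)
    (fun j => (h j).imp fun ψ hψ => hψ)
    ((isCompact_closedBall φ δ).of_isClosed_subset (hcl 0) Set.inter_subset_left) hcl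
  rw [Set.mem_iInter] at hψ
  refine ⟨ψ, (hψ 0).1, (hψ 0).2.1, fun t' ht' => ?_, ?_⟩
  · exact ge_of_tendsto' hε0 fun j => (hψ j).2.2.1 t' ht'
  · exact le_of_tendsto' (hε0.const_sub 1) fun j => (hψ j).2.2.2

end QTM

/-! ## Analysis of the algorithm -/

section Algorithm

variable {M : QTM} {n : ℕ} (B : BallTest M n) (I : Interpolator n) (C : SphereCover n)

theorem searchDown_isSome {far near : List (RatVec n)} {δ : ℚ} {d m : ℕ} (hd : d + 1 ≤ m)
    (h : ∃ u, I.search far near (d + 1) (2 * δ) δ (7 / 4 * δ) (3 / 2 * δ) = some u) :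
    (searchDown I far near δ m).isSome := by
  induction m with
  | zero => omega
  | succ m ih =>
    rw [searchDown]
    split
    · rfl
    · rename_i hnone
      refine ih ?_
      rcases Nat.lt_or_ge d m with hlt | hge
      · exact hlt
      · obtain rfl : d = m := by omega
        obtain ⟨u, hu⟩ := h
        rw [hnone] at hu
        exact absurd hu (by simp)

/-- Only the far condition is kept: neither the near vectors nor the dimension found matter for the
dimension bound. -/
theorem searchDown_sound {far near : List (RatVec n)} {δ : ℚ} (hδ : 0 < δ) {m : ℕ}
    {W : Submodule ℂ (Qubits n)} (h : searchDown I far near δ m = some W) :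
    ∀ φ ∈ far, 3 / 2 * (δ : ℝ) < Metric.infDist φ.toQubits (W : Set (Qubits n)) := by
  induction m with
  | zero => simp [searchDown] at h
  | succ m ih =>
    rw [searchDown] at h
    split at h
    · rename_i u hu
      obtain rfl := Option.some.inj h
      have := (I.sound far near (m + 1) (2 * δ) δ (7 / 4 * δ) (3 / 2 * δ) (by omega) hδ
        (by linarith) (by linarith) (by linarith) u hu).2.2
      intro φ hφ
      simpa using this φ hφ
    · exact ih h

variable {I} in
/-- The output of a round contains only vectors that are approximately halting. -/
theorem algorithmRound_isHalting {δ : ℚ} (hδ : 0 < δ) {t : ℕ+} {j : ℕ}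
    {r : Submodule ℂ (Qubits n) × ℚ} (h : algorithmRound B I C δ t j = some r)
    {ψ : Qubits n} (hψ : ψ ∈ r.1) (hn : ‖ψ‖ = 1) : M.IsHalting (20 * δ) t ψ := by
  have hδ' : (0 : ℝ) < δ := by exact_mod_cast hδ
  simp only [algorithmRound] at h
  split_ifs at h with hnear
  · obtain rfl := Option.some.inj h
    rw [Submodule.mem_bot] at hψ
    simp [hψ] at hn
  · obtain ⟨W, hW, rfl⟩ := Option.map_eq_some_iff.mp h
    -- The centre `φ` is within `δ < 3/2 δ` of the output space, so it was not rejected at accuracy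
    -- `18δ`. Its ball contains an `18δ`-halting unit vector within `2δ` of `ψ`, whence `20δ`.
    obtain ⟨φ, hφ, hψφ⟩ := C.covers δ hδ ψ hn
    have htest : B.test φ δ (18 * δ) t = true := by
      by_contra hf
      have hfar := searchDown_sound I hδ hW φ (List.mem_filter.mpr ⟨hφ, by simpa using hf⟩)
      have := Metric.infDist_le_dist_of_mem (x := φ.toQubits) (show ψ ∈ (W : Set (Qubits n)) from hψ)
      rw [Metric.mem_ball, dist_comm] at hψφ
      linarith
    have hball : M.BallIsHalting δ (18 * δ : ℚ) t φ.toQubits := by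
      by_contra hb
      rw [B.eq_false φ δ (18 * δ) t hδ (by linarith) hb] at htest
      exact absurd htest (by simp)
    obtain ⟨v, hv, hv1, hvh⟩ := hball
    have hd : ‖ψ - v‖ ≤ 2 * δ := by
      rw [← dist_eq_norm]
      rw [Metric.mem_ball] at hv hψφ
      linarith [dist_triangle_right ψ v φ.toQubits]
    have := hvh.of_norm_sub_le hn hv1 hd
    exact this.mono (by push_cast; linarith)

/-- Either the ball is halting for every accuracy and its closure meets the exact halting space, or
it stops being halting at some round and is rejected from then on. -/
theorem eventually_test_imp_infDist_le {δ : ℚ} (hδ : 0 < δ) (t : ℕ+) (φ : RatVec n) :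
    ∀ᶠ j in Filter.atTop, B.test φ δ (roundAccuracy δ j) t = true →
      Metric.infDist φ.toQubits (M.haltingSpace n t : Set (Qubits n)) ≤ δ := by
  have hδ' : (0 : ℝ) < δ := by exact_mod_cast hδ
  have hacc : ∀ j, ((roundAccuracy δ j : ℚ) : ℝ) = 18 * δ * (1 / 2) ^ j := fun j => by
    simp [roundAccuracy, div_eq_mul_inv]
  have hanti : Antitone fun j => ((roundAccuracy δ j : ℚ) : ℝ) := by
    intro i j hij
    simp only [hacc]
    exact mul_le_mul_of_nonneg_left
      (pow_le_pow_of_le_one (by norm_num) (by norm_num) hij) (by positivity)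
  have htend : Filter.Tendsto (fun j => ((roundAccuracy δ j : ℚ) : ℝ)) Filter.atTop (nhds 0) := by
    simp only [hacc]
    simpa using (tendsto_pow_atTop_nhds_zero_of_lt_one (r := (1 / 2 : ℝ)) (by norm_num)
      (by norm_num)).const_mul (18 * (δ : ℝ))
  by_cases h : ∀ j, M.BallIsHalting δ (roundAccuracy δ j) t φ.toQubits
  · obtain ⟨ψ, hψ, hψ1, hψh⟩ := QTM.exists_isHalting_zero hanti htend (fun j => by
      obtain ⟨ψ, hψ, h'⟩ := h j
      exact ⟨ψ, Metric.ball_subset_closedBall hψ, h'⟩)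
    refine Filter.Eventually.of_forall fun j _ => ?_
    refine (Metric.infDist_le_dist_of_mem
      (show ψ ∈ (M.haltingSpace n t : Set (Qubits n)) from hψh.mem_haltingSpace hψ1)).trans ?_
    rwa [dist_comm]
  · push Not at h
    obtain ⟨j₀, hj₀⟩ := h
    filter_upwards [Filter.eventually_ge_atTop j₀] with j hj htest
    have hnot : ¬ M.BallIsHalting δ (roundAccuracy δ j) t φ.toQubits := by
      rintro ⟨ψ, hψ, hψ1, hψh⟩
      exact hj₀ ⟨ψ, hψ, hψ1, hψh.mono (hanti hj)⟩
    rw [B.eq_false φ δ _ t hδ (by unfold roundAccuracy; positivity) hnot] at htest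
    exact absurd htest (by simp)

variable {B C} in
-- A centre closer than this, once normalised, is a witness that obliges `B` to accept.
theorem le_infDist_of_test_eq_false {δ : ℚ} (hδ : 0 < δ) (hδ1 : δ < 1 / 80) {t : ℕ+}
    {φ : RatVec n} (hφ : φ ∈ C.centres δ) (htest : B.test φ δ (18 * δ) t = false) :
    7 / 4 * (δ : ℝ) ≤ Metric.infDist φ.toQubits (M.haltingSpace n t : Set (Qubits n)) := by
  have hδ' : (0 : ℝ) < δ := by exact_mod_cast hδ
  have hδ1' : (δ : ℝ) < 1 / 80 := by
    have : ((δ : ℚ) : ℝ) < ((1 / 80 : ℚ) : ℝ) := by exact_mod_cast hδ1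
    simpa using this
  by_contra! hlt
  obtain ⟨w, hw, hdist⟩ := (Metric.infDist_lt_iff ⟨0, (M.haltingSpace n t).zero_mem⟩).mp hlt
  obtain ⟨hn1, hn2⟩ := C.norm_mem δ hδ φ hφ
  set x := φ.toQubits
  have hxpos : 0 < ‖x‖ := by linarith
  have hx0 : x ≠ 0 := norm_pos_iff.mp hxpos
  have hunit : ‖((‖x‖⁻¹ : ℝ) : ℂ) • x‖ = 1 := by
    rw [norm_smul, Complex.norm_real, norm_inv, norm_norm, inv_mul_cancel₀ hxpos.ne']
  have hball : ‖((‖x‖⁻¹ : ℝ) : ℂ) • x - x‖ < δ := by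
    have : ((‖x‖⁻¹ : ℝ) : ℂ) • x - x = ((‖x‖⁻¹ - 1 : ℝ) : ℂ) • x := by
      push_cast; rw [sub_smul, one_smul]
    rw [this, norm_smul, Complex.norm_real, Real.norm_eq_abs, ← abs_of_pos hxpos, ← abs_mul,
      abs_of_pos hxpos, sub_mul, inv_mul_cancel₀ hxpos.ne', one_mul, abs_lt]
    constructor <;> linarith
  -- Normalising inflates `7/4 δ` by `‖x‖⁻¹`; as `‖x‖ > 1 - δ/2` and `δ` is small, the result stays
  -- below `2δ`.
  have hnear : ‖((‖x‖⁻¹ : ℝ) : ℂ) • x - ((‖x‖⁻¹ : ℝ) : ℂ) • w‖ ≤ 2 * δ := by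
    rw [← smul_sub, norm_smul, Complex.norm_real, norm_inv, norm_norm, inv_mul_le_iff₀ hxpos,
      ← dist_eq_norm]
    nlinarith
  have hhalt := QTM.isHalting_of_mem_haltingSpace hunit
    ((M.haltingSpace n t).smul_mem _ hw) hnear
  -- Acceptance is guaranteed at a quarter of `18δ`, and `(2δ)² ≤ 18δ/4`.
  have htrue := B.eq_true φ δ (18 * δ) t hδ (by linarith)
    ⟨_, by rwa [Metric.mem_ball, dist_eq_norm], hunit, hhalt.mono (by push_cast; nlinarith)⟩
  rw [htrue] at htest
  exact absurd htest (by simp)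

theorem approxHalting_dom {δ : ℚ} (hδ : 0 < δ) (hδ1 : δ < 1 / 80) (t : ℕ+) :
    (approxHalting B I C δ t).Dom := by
  have hδ' : (0 : ℝ) < δ := by exact_mod_cast hδ
  have hδ1' : (δ : ℝ) < 1 / 80 := by
    have : ((δ : ℚ) : ℝ) < ((1 / 80 : ℚ) : ℝ) := by exact_mod_cast hδ1
    simpa using this
  -- As there are finitely many centres, one round works for all of them.
  obtain ⟨j, hj⟩ := ((Filter.eventually_all_finite (List.finite_toSet (C.centres δ))).mpr
    fun φ _ => eventually_test_imp_infDist_le B hδ t φ).exists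
  refine ⟨j, ?_⟩
  simp only [algorithmRound]
  split_ifs with hnear
  · rfl
  rw [Option.isSome_map]
  have hclose : ∀ φ ∈ (C.centres δ).filter fun ψ => B.test ψ δ (roundAccuracy δ j) t,
      Metric.infDist φ.toQubits (M.haltingSpace n t : Set (Qubits n)) ≤ δ := fun φ hφ =>
    hj φ (List.mem_filter.mp hφ).1 (by simpa using (List.mem_filter.mp hφ).2)
  -- Dimension `0` is never searched. An accepted centre has norm above `1 - δ/2 > δ`, so it cannot
  -- be within `δ` of `{0}`.
  have hpos : 0 < Module.finrank ℂ (M.haltingSpace n t) := by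
    obtain ⟨φ, hφ⟩ := List.exists_mem_of_ne_nil _ hnear
    rw [Nat.pos_iff_ne_zero, Ne, Submodule.finrank_eq_zero]
    intro hbot
    have h1 := hclose φ hφ
    have h2 := (C.norm_mem δ hδ φ (List.mem_filter.mp hφ).1).1
    rw [hbot, Submodule.bot_coe, Metric.infDist_singleton, dist_zero_right] at h1
    linarith
  have hle : Module.finrank ℂ (M.haltingSpace n t) ≤ 2 ^ n := by
    simpa using (M.haltingSpace n t).finrank_le
  obtain ⟨d, hd⟩ : ∃ d, Module.finrank ℂ (M.haltingSpace n t) = d + 1 :=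
    Nat.exists_eq_succ_of_ne_zero hpos.ne'
  refine searchDown_isSome I (hd ▸ hle) ?_
  refine I.complete _ _ (d + 1) (2 * δ) δ (7 / 4 * δ) (3 / 2 * δ) (by omega) hδ (by linarith)
    (by linarith) (by linarith) ⟨M.haltingSpace n t, hd, hclose, fun φ hφ => ?_⟩
  have hfar := List.mem_filter.mp hφ
  have := le_infDist_of_test_eq_false hδ hδ1 hfar.1 (by simpa using hfar.2)
  simpa using this

end Algorithm

theorem mainTheorem6 (M : QTM) (n : ℕ) (B : BallTest M n) (I : Interpolator n) (C : SphereCover n)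
    (δ : ℚ) (hδ_pos : 0 < δ) (hδ : δ < 1 / 80 * (2 ^ (2 * n))⁻¹) :
    ∃ halts : ∀ t : ℕ+, (approxHalting B I C δ t).Dom,
      ∑' t : ℕ+, (Module.finrank ℂ ((approxHalting B I C δ t).get (halts t)).1 : ENNReal) ≤ 2 ^ n := by
  have hδ1 : δ < 1 / 80 := by
    have : ((2 : ℚ) ^ (2 * n))⁻¹ ≤ 1 := inv_le_one_of_one_le₀ (one_le_pow₀ (by norm_num))
    linarith
  have hfin : Module.finrank ℂ (Qubits n) = 2 ^ n := by simp
  have hsqrt : 2 * √(20 * (δ : ℝ)) < ((Module.finrank ℂ (Qubits n) : ℝ))⁻¹ := by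
    have hcast : (δ : ℝ) < 1 / 80 * (2 ^ (2 * n))⁻¹ := by
      have : ((δ : ℚ) : ℝ) < ((1 / 80 * (2 ^ (2 * n))⁻¹ : ℚ) : ℝ) := by exact_mod_cast hδ
      simpa using this
    -- Squaring `2√(20δ) < 2⁻ⁿ` gives `80δ < 2⁻²ⁿ`, the origin of the constant `1/80`.
    rw [hfin, ← lt_div_iff₀' (by norm_num), Real.sqrt_lt' (by positivity)]
    push_cast
    rw [div_pow, inv_pow, ← pow_mul, mul_comm n 2]
    linarith
  refine ⟨approxHalting_dom B I C hδ_pos hδ1, ?_⟩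
  -- The bound `20δ` holds whichever round produced the output.
  have hhalt : ∀ t : ℕ+, ∀ ψ ∈ ((approxHalting B I C δ t).get
      (approxHalting_dom B I C hδ_pos hδ1 t)).1, ‖ψ‖ = 1 → M.IsHalting (20 * δ) t ψ :=
    fun t ψ hψ hn => algorithmRound_isHalting B C hδ_pos (Option.some_get _).symm hψ hn
  refine ENNReal.summable.tsum_le_of_sum_le fun s => ?_
  have := sum_finrank_le_of_norm_inner_lt s (fun t : ℕ+ => ((approxHalting B I C δ t).get
      (approxHalting_dom B I C hδ_pos hδ1 t)).1) fun t t' htt' x hx y hy hx1 hy1 => by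
    rcases lt_or_gt_of_ne htt' with hlt | hlt
    · exact ((hhalt t x hx hx1).norm_inner_le hlt hx1 hy1 (hhalt t' y hy hy1)).trans_lt hsqrt
    · rw [← norm_inner_symm]
      exact ((hhalt t' y hy hy1).norm_inner_le hlt hy1 hx1 (hhalt t x hx hx1)).trans_lt hsqrt
  rw [hfin] at this
  exact_mod_cast this
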